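/- Let $n,l\in\mathbb N$ and let $S_1,\dots,S_l:\mathbb R^n\to\mathbb R^n$ be similarities without rotations, $S_i(x)=\lambda_i x+d_i$ with $\lambda_i\in(0,1)$ and $d_i\in\mathbb R^n$. Let $E$ be their attractor, i.e. the non-empty compact set with $E=\bigcup_{i=1}^l S_i(E)$, and let $s=\dim_H E$ be its Hausdorff dimension. For a unit vector $\theta\in\mathbb R^n$ let $\pi_\theta(y)=\langle\theta,y\rangle$ be the orthogonal projection onto the line $\mathbb R\theta$ (identified with $\mathbb R$), and for $x\in\mathbb R$ let $E_{\theta,x}=\{y\in E:\pi_\theta(y)=x\}$ be the corresponding slice of $E$. Suppose that 1. (open set condition) there is a non-empty open set $V\subset\mathbb R^n$ such that the sets $S_1(V),\dots,S_l(V)$ are pairwise disjoint and contained in $V$; 2. (slice coding condition) for every unit vector $\theta$ there is $\delta>0$ such that for every $x\in\pi_\theta(E)$ either the diameter of $E_{\theta,x}$ exceeds $\delta$, or $E_{\theta,x}\subset S_a(E)$ for some $a\in\{1,\dots,l\}$. Fix a unit vector $\theta$ and let $\nu_\theta=(\mathcal H^s|_E)\circ\pi_\theta^{-1}$ be the projection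 of $s$-dimensional Hausdorff measure on $E$. If $\nu_\theta$ is absolutely continuous with respect to Lebesgue measure on $\mathbb R$ with (essentially) bounded density, then $\mathcal H^{s-1}(E_{\theta,x})>0$ for $\nu_\theta$-almost every $x$. -/

import Mathlib

open Set MeasureTheory Measure
open scoped NNReal ENNReal RealInnerProductSpace

/-- An iterated function system of `l` similarities of `ℝⁿ` without rotations:
the maps are `S i x = ratio i • x + shift i` with `ratio i ∈ (0, 1)`. -/
structure HomothetyIFS (n l : ℕ) where
  ratio : Fin l → ℝ
  shift : Fin l → EuclideanSpace ℝ (Fin n)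
  ratio_pos : ∀ i, 0 < ratio i
  ratio_lt_one : ∀ i, ratio i < 1

namespace HomothetyIFS

variable {n l : ℕ} (S : HomothetyIFS n l)

/-- The `i`-th map of the system. -/
def map (i : Fin l) (x : EuclideanSpace ℝ (Fin n)) : EuclideanSpace ℝ (Fin n) :=
  S.ratio i • x + S.shift i

/-- `E` is the attractor (the self-similar set) of the system. -/
def IsAttractor (E : Set (EuclideanSpace ℝ (Fin n))) : Prop :=
  E.Nonempty ∧ IsCompact E ∧ E = ⋃ i, S.map i '' E

/-- The open set condition. -/
def OpenSetCondition : Prop :=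
  ∃ V : Set (EuclideanSpace ℝ (Fin n)), IsOpen V ∧ V.Nonempty ∧
    (⋃ i, S.map i '' V) ⊆ V ∧ Pairwise (fun i j => Disjoint (S.map i '' V) (S.map j '' V))

end HomothetyIFS

/-- Orthogonal projection of `ℝⁿ` onto the line `ℝ u` spanned by a unit vector `u`,
where the line is identified with `ℝ` through `t ↦ t • u`. -/
noncomputable def lineProj {n : ℕ} (u x : EuclideanSpace ℝ (Fin n)) : ℝ := ⟪u, x⟫

/-- The slice of `E` by the hyperplane orthogonal to `u` through the point `t • u`. -/
def slice {n : ℕ} (E : Set (EuclideanSpace ℝ (Fin n))) (u : EuclideanSpace ℝ (Fin n)) (t : ℝ) :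
    Set (EuclideanSpace ℝ (Fin n)) :=
  E ∩ {y | lineProj u y = t}

/-- The slice coding condition: for each direction `u` there is `δ > 0` such that each nonempty
slice of `E` orthogonal to `u` has diameter larger than `δ` or lies in one piece `S a '' E`. -/
def HomothetyIFS.SliceCodingCondition {n l : ℕ} (S : HomothetyIFS n l)
    (E : Set (EuclideanSpace ℝ (Fin n))) : Prop :=
  ∀ u : EuclideanSpace ℝ (Fin n), ‖u‖ = 1 → ∃ δ : ℝ, 0 < δ ∧
    ∀ t ∈ lineProj u '' E, δ < Metric.diam (slice E u t) ∨ ∃ a, slice E u t ⊆ S.map a '' E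

/-- The image under `lineProj u` of `s`-dimensional Hausdorff measure restricted to `E`. -/
noncomputable def projHausdorff {n : ℕ} (E : Set (EuclideanSpace ℝ (Fin n))) (s : ℝ)
    (u : EuclideanSpace ℝ (Fin n)) : Measure ℝ :=
  ((μH[s] : Measure (EuclideanSpace ℝ (Fin n))).restrict E).map (lineProj u)

/-- `ν` is absolutely continuous with respect to Lebesgue measure, with an (essentially)
bounded density. -/
def HasBoundedDensity (ν : Measure ℝ) : Prop :=
  ∃ h : ℝ → ℝ≥0, Measurable h ∧ (∃ C : ℝ≥0, ∀ᵐ t ∂(volume : Measure ℝ), h t ≤ C) ∧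
    ν = (volume : Measure ℝ).withDensity (fun t => (h t : ℝ≥0∞))

/-- The projection is measurable, so the image measure above is not a junk value. -/
theorem measurable_lineProj {n : ℕ} (u : EuclideanSpace ℝ (Fin n)) : Measurable (lineProj u) := by
  unfold lineProj
  fun_prop

/-!
Write `ν` for `projHausdorff E s u`, and `h ≤ C` for its density.

If `s ≤ 1`, then `μH[s - 1]` dominates the counting measure, and `ν`-almost every slice is nonempty.

Let `s > 1`. A copy `a • E + b` of `E` meets the slab of width `2 * ε` over `t` in a set of
`μH[s]`-measure at most `a ^ s * ν (closedBall t' (ε / a)) ≤ C * a ^ (s - 1) * (2 * ε)`, since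
rescaling the copy to `E` turns the slab into one of width `2 * ε / a`
(`hausdorffMeasure_homothetyMap_slab_le`). By the open set condition, the part of `E` in a ball of
radius `r ≤ 1` is covered by a bounded number `K` of such copies with `a ≤ r`
(`HomothetyIFS.OpenSetCondition.exists_card_cover_le`).

Suppose that the slice over `t` has `μH[s - 1]`-measure zero, and let `η > 0`. The slice is covered
by balls of radii `r k` with `∑' k, r k ^ (s - 1) ≤ η`, and by compactness these balls contain
the part of `E` over `closedBall t ε` for small `ε`. Hence `ν (closedBall t ε) ≤ K * C * η * (2 * ε)`
(`eventually_projHausdorff_closedBall_le`). As `η` is arbitrary, `ν` has density zero at `t`, and the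
Besicovitch differentiation theorem gives `h t = 0` for Lebesgue-almost every such `t`. These points
form a `ν`-null set.
-/

/-! ### Coverings by balls of sets of Hausdorff measure zero -/

theorem exists_gt_ofReal_rpow_le {t : ℝ} (ht : 0 < t) {r₀ : ℝ} (h₁ : r₀ < 1)
    {e : ℝ≥0∞} (he : 0 < e) :
    ∃ r, r₀ < r ∧ r ≤ 1 ∧ ENNReal.ofReal r ^ t ≤ ENNReal.ofReal r₀ ^ t + e := by
  have hcont : Continuous fun r : ℝ => ENNReal.ofReal r ^ t :=
    ENNReal.continuous_rpow_const.comp ENNReal.continuous_ofReal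
  have hfin : ENNReal.ofReal r₀ ^ t ≠ ∞ :=
    ENNReal.rpow_ne_top_of_nonneg ht.le ENNReal.ofReal_ne_top
  have hlt : ENNReal.ofReal r₀ ^ t < ENNReal.ofReal r₀ ^ t + e :=
    ENNReal.lt_add_right hfin he.ne'
  have h₂ : ∀ᶠ r in nhdsWithin r₀ (Ioi r₀), ENNReal.ofReal r ^ t < ENNReal.ofReal r₀ ^ t + e :=
    nhdsWithin_le_nhds (hcont.continuousAt.eventually_lt_const hlt)
  have h₃ : ∀ᶠ r in nhdsWithin r₀ (Ioi r₀), r < 1 :=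
    nhdsWithin_le_nhds (eventually_lt_nhds h₁)
  obtain ⟨r, hr, hr1, hr0⟩ := (h₂.and (h₃.and self_mem_nhdsWithin)).exists
  exact ⟨r, hr0, hr1.le, hr.le⟩

/-- A set of `t`-dimensional Hausdorff measure zero has coverings by open balls of radius at
most one with arbitrarily small `t`-th power sums of the radii. -/
theorem exists_ball_cover_of_hausdorffMeasure_eq_zero {X : Type*} [MetricSpace X]
    [MeasurableSpace X] [BorelSpace X] [Nonempty X] {t : ℝ} (ht : 0 < t) {A : Set X}
    (hA : μH[t] A = 0) {η : ℝ≥0∞} (hη : η ≠ 0) :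
    ∃ (y : ℕ → X) (r : ℕ → ℝ), (∀ k, 0 < r k) ∧ (∀ k, r k ≤ 1) ∧
      A ⊆ ⋃ k, Metric.ball (y k) (r k) ∧ ∑' k, ENNReal.ofReal (r k) ^ t ≤ η := by
  have hη2 : η / 2 ≠ 0 := (ENNReal.half_pos hη).ne'
  obtain ⟨e, he, hesum⟩ := ENNReal.exists_pos_sum_of_countable' hη2 ℕ
  have hhalf : (0 : ℝ≥0∞) < ENNReal.ofReal (1 / 2) := by simp
  have hinf : (⨅ (T : ℕ → Set X) (_ : A ⊆ ⋃ k, T k)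
      (_ : ∀ k, Metric.ediam (T k) ≤ ENNReal.ofReal (1 / 2)),
      ∑' k, ⨆ (_ : (T k).Nonempty), Metric.ediam (T k) ^ t) < η / 2 := by
    refine lt_of_le_of_lt ?_ (pos_iff_ne_zero.2 hη2)
    rw [← hA, hausdorffMeasure_apply]
    exact le_iSup₂ (f := fun r (_ : 0 < r) => ⨅ (T : ℕ → Set X) (_ : A ⊆ ⋃ k, T k)
      (_ : ∀ k, Metric.ediam (T k) ≤ r),
      ∑' k, ⨆ (_ : (T k).Nonempty), Metric.ediam (T k) ^ t) (ENNReal.ofReal (1 / 2)) hhalf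
  simp only [iInf_lt_iff] at hinf
  obtain ⟨T, hcov, hdiam, hsum⟩ := hinf
  have key : ∀ k, ∃ (y : X) (r : ℝ), 0 < r ∧ r ≤ 1 ∧ T k ⊆ Metric.ball y r ∧
      ENNReal.ofReal r ^ t ≤ (⨆ (_ : (T k).Nonempty), Metric.ediam (T k) ^ t) + e k := by
    intro k
    rcases (T k).eq_empty_or_nonempty with h | h
    · obtain ⟨r, hr0, hr1, hr⟩ := exists_gt_ofReal_rpow_le ht one_pos (he k)
      refine ⟨Classical.arbitrary X, r, hr0, hr1, by simp [h], hr.trans ?_⟩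
      simp [ENNReal.zero_rpow_of_pos ht]
    · have hfin : Metric.ediam (T k) ≠ ∞ := ne_top_of_le_ne_top ENNReal.ofReal_ne_top (hdiam k)
      have hlt : (Metric.ediam (T k)).toReal < 1 := by
        have := ENNReal.toReal_mono ENNReal.ofReal_ne_top (hdiam k)
        rw [ENNReal.toReal_ofReal (by norm_num)] at this
        linarith
      obtain ⟨r, hr0, hr1, hr⟩ := exists_gt_ofReal_rpow_le ht hlt (he k)
      obtain ⟨y, hy⟩ := h
      refine ⟨y, r, ENNReal.toReal_nonneg.trans_lt hr0, hr1, fun z hz => ?_, hr.trans ?_⟩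
      · rw [Metric.mem_ball, dist_edist]
        exact (ENNReal.toReal_mono hfin (Metric.edist_le_ediam_of_mem hz hy)).trans_lt hr0
      · rw [ENNReal.ofReal_toReal hfin]
        gcongr
        exact le_iSup (fun _ : (T k).Nonempty => Metric.ediam (T k) ^ t) ⟨y, hy⟩
  choose y r hr0 hr1 hsub hle using key
  refine ⟨y, r, hr0, hr1, hcov.trans (iUnion_mono hsub), ?_⟩
  calc ∑' k, ENNReal.ofReal (r k) ^ t
      ≤ ∑' k, ((⨆ (_ : (T k).Nonempty), Metric.ediam (T k) ^ t) + e k) :=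
        ENNReal.tsum_le_tsum hle
    _ = (∑' k, ⨆ (_ : (T k).Nonempty), Metric.ediam (T k) ^ t) + ∑' k, e k := ENNReal.tsum_add
    _ ≤ η / 2 + η / 2 := by gcongr
    _ = η := ENNReal.add_halves η

/-! ### Packing separated points -/

/-- The number of `σ`-separated points in a ball of a proper space is bounded. -/
theorem exists_card_le_of_separated {X : Type*} [PseudoMetricSpace X] [ProperSpace X]
    (x : X) (R : ℝ) {σ : ℝ} (hσ : 0 < σ) :
    ∃ K : ℕ, ∀ {ι : Type} (F : Finset ι) (φ : ι → X),
      (∀ p ∈ F, φ p ∈ Metric.closedBall x R) →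
      (∀ p ∈ F, ∀ q ∈ F, p ≠ q → σ ≤ dist (φ p) (φ q)) → F.card ≤ K := by
  obtain ⟨T, -, hfin, hcov⟩ := (isCompact_closedBall x R).finite_cover_balls (half_pos hσ)
  refine ⟨hfin.toFinset.card, fun {ι} F φ hmem hsep => ?_⟩
  have hc : ∀ p : ι, ∃ z : X, p ∈ F → z ∈ T ∧ dist (φ p) z < σ / 2 := fun p => by
    by_cases hp : p ∈ F
    · obtain ⟨z, hz, hd⟩ := mem_iUnion₂.1 (hcov (hmem p hp))
      exact ⟨z, fun _ => ⟨hz, hd⟩⟩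
    · exact ⟨x, fun h => absurd h hp⟩
  choose c hc using hc
  refine Finset.card_le_card_of_injOn c (fun p hp => by simpa using (hc p hp).1) ?_
  intro p hp q hq hpq
  by_contra hne
  have h₁ := (hc p hp).2
  have h₂ := (hc q hq).2
  rw [← hpq] at h₂
  have := dist_triangle_right (φ p) (φ q) (c p)
  linarith [hsep p hp q hq hne]

/-! ### Small copies of the attractor -/

/-- The homothety `x ↦ a • x + b`, parametrised by the pair `p = (a, b)`. Finite compositions of
the maps of a `HomothetyIFS` are of this form, so a family of cylinders can be recorded as a set of
pairs instead of a set of words. -/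
noncomputable def homothetyMap {n : ℕ} (p : ℝ × EuclideanSpace ℝ (Fin n))
    (x : EuclideanSpace ℝ (Fin n)) : EuclideanSpace ℝ (Fin n) :=
  p.1 • x + p.2

theorem homothetyMap_map {n l : ℕ} (S : HomothetyIFS n l) (p : ℝ × EuclideanSpace ℝ (Fin n))
    (i : Fin l) (x : EuclideanSpace ℝ (Fin n)) :
    homothetyMap p (S.map i x) = homothetyMap (p.1 * S.ratio i, p.1 • S.shift i + p.2) x := by
  simp only [homothetyMap, HomothetyIFS.map]
  module

theorem image_homothetyMap_image_map {n l : ℕ} (S : HomothetyIFS n l)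
    (p : ℝ × EuclideanSpace ℝ (Fin n)) (i : Fin l) (A : Set (EuclideanSpace ℝ (Fin n))) :
    homothetyMap p '' (S.map i '' A) =
      homothetyMap (p.1 * S.ratio i, p.1 • S.shift i + p.2) '' A := by
  rw [image_image]
  exact image_congr fun x _ => homothetyMap_map S p i x

theorem injective_homothetyMap {n : ℕ} {p : ℝ × EuclideanSpace ℝ (Fin n)} (hp : p.1 ≠ 0) :
    Function.Injective (homothetyMap p) := fun x y h => by
  simpa [homothetyMap, hp] using h

theorem dist_homothetyMap {n : ℕ} (p : ℝ × EuclideanSpace ℝ (Fin n))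
    (x y : EuclideanSpace ℝ (Fin n)) :
    dist (homothetyMap p x) (homothetyMap p y) = |p.1| * dist x y := by
  simp [homothetyMap, dist_smul₀]

theorem lineProj_homothetyMap {n : ℕ} (u : EuclideanSpace ℝ (Fin n))
    (p : ℝ × EuclideanSpace ℝ (Fin n)) (x : EuclideanSpace ℝ (Fin n)) :
    lineProj u (homothetyMap p x) = p.1 * lineProj u x + lineProj u p.2 := by
  simp [homothetyMap, lineProj, inner_add_right, inner_smul_right]

/-- A finite family of homothetic copies of `E`, of ratios between `m * r` and `r`, covering `E`,
for which the corresponding copies of `V` are pairwise disjoint. -/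
structure IsCylinderCover {n : ℕ} (E V : Set (EuclideanSpace ℝ (Fin n))) (m r : ℝ)
    (F : Finset (ℝ × EuclideanSpace ℝ (Fin n))) : Prop where
  le_ratio : ∀ p ∈ F, m * r ≤ p.1
  ratio_le : ∀ p ∈ F, p.1 ≤ r
  cover : E ⊆ ⋃ p ∈ F, homothetyMap p '' E
  disjoint : ∀ p ∈ F, ∀ q ∈ F, p ≠ q → Disjoint (homothetyMap p '' V) (homothetyMap q '' V)

/-- Subdividing once the cylinders which are larger than `r'` gives a cover at scale `r'`. -/
theorem IsCylinderCover.refine {n l : ℕ} {S : HomothetyIFS n l}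
    {E V : Set (EuclideanSpace ℝ (Fin n))} (hE : E = ⋃ i, S.map i '' E)
    (hV : (⋃ i, S.map i '' V) ⊆ V)
    (hdisj : Pairwise (fun i j => Disjoint (S.map i '' V) (S.map j '' V))) {m q r r' : ℝ}
    (hm : 0 < m) (hmi : ∀ i, m ≤ S.ratio i) (hqi : ∀ i, S.ratio i ≤ q)
    (hr' : 0 < r') (hle : r' ≤ r) (hqr : q * r ≤ r')
    {F : Finset (ℝ × EuclideanSpace ℝ (Fin n))} (hF : IsCylinderCover E V m r F) :
    ∃ F', IsCylinderCover E V m r' F' := by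
  classical
  have hpos : ∀ p ∈ F, 0 < p.1 := fun p hp =>
    (mul_pos hm (hr'.trans_le hle)).trans_le (hF.le_ratio p hp)
  let sub : (ℝ × EuclideanSpace ℝ (Fin n)) × Fin l → ℝ × EuclideanSpace ℝ (Fin n) :=
    fun a => (a.1.1 * S.ratio a.2, a.1.1 • S.shift a.2 + a.1.2)
  have hsub : ∀ p i (A : Set (EuclideanSpace ℝ (Fin n))),
      homothetyMap (sub (p, i)) '' A = homothetyMap p '' (S.map i '' A) := fun p i A =>
    (image_homothetyMap_image_map S p i A).symm
  let F' := F.filter (fun p => p.1 ≤ r') ∪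
    ((F.filter (fun p => r' < p.1)) ×ˢ Finset.univ).image sub
  have hF' : ∀ p, p ∈ F' ↔ (p ∈ F ∧ p.1 ≤ r') ∨ ∃ a i, (a ∈ F ∧ r' < a.1) ∧ sub (a, i) = p := by
    intro p
    simp [F']
  have hVsub : ∀ p i, homothetyMap (sub (p, i)) '' V ⊆ homothetyMap p '' V := fun p i => by
    rw [hsub]
    exact image_mono ((subset_iUnion (fun i => S.map i '' V) i).trans hV)
  refine ⟨F', ⟨?_, ?_, ?_, ?_⟩⟩
  · intro p hp
    rcases (hF' p).1 hp with ⟨h, -⟩ | ⟨a, i, ⟨ha, har⟩, rfl⟩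
    · exact (mul_le_mul_of_nonneg_left hle hm.le).trans (hF.le_ratio p h)
    · change m * r' ≤ a.1 * S.ratio i
      rw [mul_comm a.1]
      exact mul_le_mul (hmi i) har.le hr'.le (S.ratio_pos i).le
  · intro p hp
    rcases (hF' p).1 hp with ⟨-, h⟩ | ⟨a, i, ⟨ha, har⟩, rfl⟩
    · exact h
    · change a.1 * S.ratio i ≤ r'
      rw [mul_comm a.1]
      exact (mul_le_mul (hqi i) (hF.ratio_le a ha) (hpos a ha).le
        ((S.ratio_pos i).le.trans (hqi i))).trans hqr
  · intro x hx
    obtain ⟨p, hp, hxp⟩ := mem_iUnion₂.1 (hF.cover hx)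
    by_cases hpr : p.1 ≤ r'
    · exact mem_iUnion₂.2 ⟨p, (hF' p).2 (Or.inl ⟨hp, hpr⟩), hxp⟩
    · rw [hE, image_iUnion] at hxp
      obtain ⟨i, hi⟩ := mem_iUnion.1 hxp
      rw [← hsub] at hi
      exact mem_iUnion₂.2 ⟨_, (hF' _).2 (Or.inr ⟨p, i, ⟨hp, not_le.1 hpr⟩, rfl⟩), hi⟩
  · intro p hp p' hp' hne
    rcases (hF' p).1 hp with ⟨h, h1⟩ | ⟨a, i, ⟨ha, har⟩, rfl⟩ <;>
    rcases (hF' p').1 hp' with ⟨h', h1'⟩ | ⟨a', i', ⟨ha', har'⟩, rfl⟩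
    · exact hF.disjoint p h p' h' hne
    · refine (hF.disjoint p h a' ha' ?_).mono_right (hVsub a' i')
      rintro rfl
      exact absurd h1 (not_le.2 har')
    · refine (hF.disjoint a ha p' h' ?_).mono_left (hVsub a i)
      rintro rfl
      exact absurd h1' (not_le.2 har)
    · by_cases haa : a = a'
      · subst haa
        have hii : i ≠ i' := by
          rintro rfl
          exact hne rfl
        rw [hsub, hsub, disjoint_image_iff (injective_homothetyMap (hpos a ha).ne')]
        exact hdisj hii
      · exact (hF.disjoint a ha a' ha' haa).mono (hVsub a i) (hVsub a' i')

theorem exists_isCylinderCover {n l : ℕ} {S : HomothetyIFS n l}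
    {E V : Set (EuclideanSpace ℝ (Fin n))} (hE : E = ⋃ i, S.map i '' E)
    (hV : (⋃ i, S.map i '' V) ⊆ V)
    (hdisj : Pairwise (fun i j => Disjoint (S.map i '' V) (S.map j '' V))) {m q : ℝ}
    (hm : 0 < m) (hm1 : m ≤ 1) (hmi : ∀ i, m ≤ S.ratio i) (hq : 0 < q) (hq1 : q < 1)
    (hqi : ∀ i, S.ratio i ≤ q) {r : ℝ} (hr : 0 < r) (hr1 : r ≤ 1) :
    ∃ F, IsCylinderCover E V m r F := by
  have hpow : ∀ k : ℕ, ∃ F, IsCylinderCover E V m (q ^ k) F := by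
    intro k
    induction k with
    | zero =>
      refine ⟨{(1, 0)}, ⟨by simpa using hm1, by simp, fun x hx => ?_, by simp⟩⟩
      exact mem_iUnion₂.2 ⟨(1, 0), Finset.mem_singleton_self _, x, hx, by simp [homothetyMap]⟩
    | succ k ih =>
      obtain ⟨F, hF⟩ := ih
      exact hF.refine hE hV hdisj hm hmi hqi (pow_pos hq _)
        (pow_le_pow_of_le_one hq.le hq1.le k.le_succ) (pow_succ' q k).ge
  obtain ⟨k, hk, hk'⟩ := exists_nat_pow_near_of_lt_one hr hr1 hq hq1
  obtain ⟨F, hF⟩ := hpow k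
  exact hF.refine hE hV hdisj hm hmi hqi hr hk' ((pow_succ' q k).ge.trans hk.le)

/-- Under the open set condition, the part of the attractor in a ball of radius `r ≤ 1` is covered
by a bounded number of homothetic copies of the attractor of ratio at most `r`. -/
theorem HomothetyIFS.OpenSetCondition.exists_card_cover_le {n l : ℕ} {S : HomothetyIFS n l}
    (hosc : S.OpenSetCondition) {E : Set (EuclideanSpace ℝ (Fin n))} (hE : S.IsAttractor E) :
    ∃ K : ℕ, ∀ (y : EuclideanSpace ℝ (Fin n)) (r : ℝ), 0 < r → r ≤ 1 →
      ∃ F : Finset (ℝ × EuclideanSpace ℝ (Fin n)), F.card ≤ K ∧ (∀ p ∈ F, 0 < p.1 ∧ p.1 ≤ r) ∧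
        E ∩ Metric.ball y r ⊆ ⋃ p ∈ F, homothetyMap p '' E := by
  classical
  obtain ⟨⟨x₀, hx₀⟩, hcomp, hfix⟩ := hE
  obtain ⟨V, hVo, ⟨a, ha⟩, hVsub, hdisj⟩ := hosc
  have : Nonempty (Fin l) := by
    rw [hfix] at hx₀
    exact ⟨(mem_iUnion.1 hx₀).choose⟩
  obtain ⟨i₀, hi₀⟩ := Finite.exists_min S.ratio
  obtain ⟨i₁, hi₁⟩ := Finite.exists_max S.ratio
  obtain ⟨ρ, hρ, hball⟩ := Metric.isOpen_iff.1 hVo a ha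
  obtain ⟨D, hD⟩ := hcomp.isBounded.subset_closedBall a
  set m := S.ratio i₀ with hmdef
  have hm : 0 < m := S.ratio_pos i₀
  obtain ⟨K, hK⟩ := exists_card_le_of_separated (0 : EuclideanSpace ℝ (Fin n)) (D + 1)
    (mul_pos hm hρ)
  refine ⟨K, fun y r hr hr1 => ?_⟩
  obtain ⟨F, hF⟩ := exists_isCylinderCover hfix hVsub hdisj hm (S.ratio_lt_one i₀).le hi₀
    (S.ratio_pos i₁) (S.ratio_lt_one i₁) hi₁ hr hr1
  have hpos : ∀ p ∈ F, 0 < p.1 := fun p hp => (mul_pos hm hr).trans_le (hF.le_ratio p hp)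
  refine ⟨F.filter fun p => (homothetyMap p '' E ∩ Metric.ball y r).Nonempty, ?_, ?_, ?_⟩
  · -- The images of `a`, rescaled by `r⁻¹` around `y`, are separated points of a fixed ball.
    have hd : ∀ z w : EuclideanSpace ℝ (Fin n),
        dist (r⁻¹ • (z - y)) (r⁻¹ • (w - y)) = r⁻¹ * dist z w := fun z w => by
      rw [dist_smul₀, dist_sub_right, Real.norm_of_nonneg (inv_nonneg.2 hr.le)]
    refine hK _ (fun p => r⁻¹ • (homothetyMap p a - y)) ?_ ?_
    · intro p hp
      obtain ⟨hpF, z, ⟨x, hx, rfl⟩, hz⟩ := Finset.mem_filter.1 hp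
      have h0 := hd (homothetyMap p a) y
      rw [sub_self, smul_zero] at h0
      rw [Metric.mem_closedBall, h0, inv_mul_le_iff₀ hr]
      have h1 : dist (homothetyMap p a) (homothetyMap p x) ≤ r * D := by
        rw [dist_homothetyMap, abs_of_pos (hpos p hpF), dist_comm]
        exact mul_le_mul (hF.ratio_le p hpF) (hD hx) dist_nonneg hr.le
      have h2 := dist_triangle (homothetyMap p a) (homothetyMap p x) y
      have h3 := Metric.mem_ball.1 hz
      linarith
    · intro p hp p' hp' hne
      have hpF := (Finset.mem_filter.1 hp).1
      have hpF' := (Finset.mem_filter.1 hp').1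
      rw [hd, ← div_eq_inv_mul, le_div_iff₀ hr]
      by_contra! hlt
      have hp0 := hpos p hpF
      refine disjoint_left.1 (hF.disjoint p hpF p' hpF' hne) ?_ (mem_image_of_mem _ ha)
      refine ⟨p.1⁻¹ • (homothetyMap p' a - p.2), hball ?_, ?_⟩
      · have h1 : homothetyMap p (p.1⁻¹ • (homothetyMap p' a - p.2)) = homothetyMap p' a := by
          simp [homothetyMap, smul_smul, hp0.ne']
        have h2 := dist_homothetyMap p (p.1⁻¹ • (homothetyMap p' a - p.2)) a
        rw [h1, abs_of_pos hp0, dist_comm] at h2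
        rw [Metric.mem_ball]
        refine lt_of_mul_lt_mul_left ?_ hp0.le
        rw [← h2]
        calc _ < m * ρ * r := hlt
          _ = m * r * ρ := by ring
          _ ≤ p.1 * ρ := by gcongr; exact hF.le_ratio p hpF
      · simp [homothetyMap, smul_smul, hp0.ne']
  · intro p hp
    have hpF := (Finset.mem_filter.1 hp).1
    exact ⟨hpos p hpF, hF.ratio_le p hpF⟩
  · rintro x ⟨hxE, hxy⟩
    obtain ⟨p, hp, hxp⟩ := mem_iUnion₂.1 (hF.cover hxE)
    exact mem_iUnion₂.2 ⟨p, Finset.mem_filter.2 ⟨hp, x, hxp, hxy⟩, hxp⟩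

/-! ### Slabs of the attractor -/

theorem continuous_lineProj {n : ℕ} (u : EuclideanSpace ℝ (Fin n)) : Continuous (lineProj u) := by
  unfold lineProj
  fun_prop

theorem projHausdorff_apply {n : ℕ} (E : Set (EuclideanSpace ℝ (Fin n))) (s : ℝ)
    (u : EuclideanSpace ℝ (Fin n)) {J : Set ℝ} (hJ : MeasurableSet J) :
    projHausdorff E s u J = μH[s] (E ∩ lineProj u ⁻¹' J) := by
  rw [projHausdorff, map_apply (measurable_lineProj u) hJ,
    restrict_apply (measurable_lineProj u hJ), inter_comm]

/-- A homothetic copy of `E` of ratio `a` has measure at most a constant times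
`a ^ (s - 1) * ε` in a slab of width `2 * ε`: the rescaled slab has width `2 * ε / a`. -/
theorem hausdorffMeasure_homothetyMap_slab_le {n : ℕ} {E : Set (EuclideanSpace ℝ (Fin n))} {s : ℝ}
    (hs : 0 ≤ s) {u : EuclideanSpace ℝ (Fin n)} {C : ℝ≥0∞}
    (hC : projHausdorff E s u ≤ C • volume) {p : ℝ × EuclideanSpace ℝ (Fin n)} (hp : 0 < p.1)
    (x ε : ℝ) :
    μH[s] (homothetyMap p '' E ∩ lineProj u ⁻¹' Metric.closedBall x ε) ≤
      ENNReal.ofReal p.1 ^ (s - 1) * (C * volume (Metric.closedBall x ε)) := by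
  have hlip : LipschitzWith p.1.toNNReal (homothetyMap p) := LipschitzWith.of_dist_le_mul
    fun y z => by rw [dist_homothetyMap, abs_of_pos hp, Real.coe_toNNReal _ hp.le]
  have hsub : homothetyMap p '' E ∩ lineProj u ⁻¹' Metric.closedBall x ε ⊆
      homothetyMap p '' (E ∩ lineProj u ⁻¹'
        Metric.closedBall ((x - lineProj u p.2) / p.1) (ε / p.1)) := by
    rintro _ ⟨⟨y, hy, rfl⟩, hyx⟩
    refine ⟨y, ⟨hy, ?_⟩, rfl⟩
    rw [mem_preimage, lineProj_homothetyMap, Metric.mem_closedBall, Real.dist_eq] at hyx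
    have heq : p.1 * lineProj u y + lineProj u p.2 - x =
        (lineProj u y - (x - lineProj u p.2) / p.1) * p.1 := by
      field_simp
      ring
    rw [heq, abs_mul, abs_of_pos hp] at hyx
    rwa [mem_preimage, Metric.mem_closedBall, Real.dist_eq, le_div_iff₀ hp]
  have hp' : ENNReal.ofReal p.1 ≠ 0 := by simpa using hp
  calc μH[s] (homothetyMap p '' E ∩ lineProj u ⁻¹' Metric.closedBall x ε)
      ≤ ENNReal.ofReal p.1 ^ s * μH[s] (E ∩ lineProj u ⁻¹'
          Metric.closedBall ((x - lineProj u p.2) / p.1) (ε / p.1)) :=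
        (measure_mono hsub).trans (hlip.hausdorffMeasure_image_le hs _)
    _ ≤ ENNReal.ofReal p.1 ^ s *
          (C * volume (Metric.closedBall ((x - lineProj u p.2) / p.1) (ε / p.1))) := by
        rw [← projHausdorff_apply E s u Metric.isClosed_closedBall.measurableSet]
        gcongr
        exact hC _
    _ = ENNReal.ofReal p.1 ^ (s - 1) * (C * volume (Metric.closedBall x ε)) := by
        rw [Real.volume_closedBall, Real.volume_closedBall, ← mul_div_assoc,
          ENNReal.ofReal_div_of_pos hp, ENNReal.rpow_sub _ _ hp' ENNReal.ofReal_ne_top,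
          ENNReal.rpow_one, div_eq_mul_inv, div_eq_mul_inv]
        ring

/-- Over a point whose slice has `(s - 1)`-dimensional measure zero, thin slabs have mass at most an
arbitrarily small multiple of their width. The hypothesis `hK` is the conclusion of
`HomothetyIFS.OpenSetCondition.exists_card_cover_le`. -/
theorem eventually_projHausdorff_closedBall_le {n : ℕ} {E : Set (EuclideanSpace ℝ (Fin n))}
    (hE : IsCompact E) {s : ℝ} (hs : 1 < s) {u : EuclideanSpace ℝ (Fin n)} {C : ℝ≥0∞}
    (hC : projHausdorff E s u ≤ C • volume) {K : ℕ}
    (hK : ∀ (y : EuclideanSpace ℝ (Fin n)) (r : ℝ), 0 < r → r ≤ 1 →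
      ∃ F : Finset (ℝ × EuclideanSpace ℝ (Fin n)), F.card ≤ K ∧ (∀ p ∈ F, 0 < p.1 ∧ p.1 ≤ r) ∧
        E ∩ Metric.ball y r ⊆ ⋃ p ∈ F, homothetyMap p '' E)
    {x : ℝ} (hx : μH[s - 1] (slice E u x) = 0) {η : ℝ≥0∞} (hη : η ≠ 0) :
    ∀ᶠ ε in nhdsWithin 0 (Ioi 0), projHausdorff E s u (Metric.closedBall x ε) ≤
      K * η * (C * volume (Metric.closedBall x ε)) := by
  obtain ⟨y, r, hr0, hr1, hcov, hsum⟩ :=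
    exists_ball_cover_of_hausdorffMeasure_eq_zero (sub_pos.2 hs) hx hη
  -- By compactness, the covering of the slice also covers all slabs of small width.
  have hclosed : IsClosed (lineProj u '' (E \ ⋃ k, Metric.ball (y k) (r k))) :=
    ((hE.diff (isOpen_iUnion fun k => Metric.isOpen_ball)).image (continuous_lineProj u)).isClosed
  have hxn : x ∉ lineProj u '' (E \ ⋃ k, Metric.ball (y k) (r k)) := by
    rintro ⟨z, ⟨hzE, hz⟩, hzx⟩
    exact hz (hcov ⟨hzE, hzx⟩)
  obtain ⟨δ, hδ, hδsub⟩ := Metric.isOpen_iff.1 hclosed.isOpen_compl x hxn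
  filter_upwards [nhdsWithin_le_nhds (eventually_lt_nhds hδ)] with ε hε
  have hslab : E ∩ lineProj u ⁻¹' Metric.closedBall x ε ⊆
      ⋃ k, E ∩ Metric.ball (y k) (r k) ∩ lineProj u ⁻¹' Metric.closedBall x ε := by
    rintro z ⟨hzE, hz⟩
    have hzn : z ∈ ⋃ k, Metric.ball (y k) (r k) := by
      by_contra hcon
      exact hδsub (Metric.closedBall_subset_ball hε hz) ⟨z, ⟨hzE, hcon⟩, rfl⟩
    obtain ⟨k, hk⟩ := mem_iUnion.1 hzn
    exact mem_iUnion.2 ⟨k, ⟨hzE, hk⟩, hz⟩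
  have hpiece : ∀ k, μH[s] (E ∩ Metric.ball (y k) (r k) ∩ lineProj u ⁻¹' Metric.closedBall x ε) ≤
      K * ENNReal.ofReal (r k) ^ (s - 1) * (C * volume (Metric.closedBall x ε)) := by
    intro k
    obtain ⟨F, hFcard, hF, hFcov⟩ := hK (y k) (r k) (hr0 k) (hr1 k)
    calc μH[s] (E ∩ Metric.ball (y k) (r k) ∩ lineProj u ⁻¹' Metric.closedBall x ε)
        ≤ μH[s] (⋃ p ∈ F, homothetyMap p '' E ∩ lineProj u ⁻¹' Metric.closedBall x ε) := by
          refine measure_mono ?_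
          rintro z ⟨hz, hzx⟩
          obtain ⟨p, hp, hzp⟩ := mem_iUnion₂.1 (hFcov hz)
          exact mem_iUnion₂.2 ⟨p, hp, hzp, hzx⟩
      _ ≤ ∑ p ∈ F, μH[s] (homothetyMap p '' E ∩ lineProj u ⁻¹' Metric.closedBall x ε) :=
          measure_biUnion_finset_le _ _
      _ ≤ ∑ p ∈ F, ENNReal.ofReal (r k) ^ (s - 1) * (C * volume (Metric.closedBall x ε)) := by
          refine Finset.sum_le_sum fun p hp => ?_
          refine (hausdorffMeasure_homothetyMap_slab_le (by linarith) hC (hF p hp).1 x ε).trans ?_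
          gcongr
          exact (hF p hp).2
      _ ≤ K * ENNReal.ofReal (r k) ^ (s - 1) * (C * volume (Metric.closedBall x ε)) := by
          rw [Finset.sum_const, nsmul_eq_mul, mul_assoc]
          gcongr
  calc projHausdorff E s u (Metric.closedBall x ε)
      = μH[s] (E ∩ lineProj u ⁻¹' Metric.closedBall x ε) :=
        projHausdorff_apply E s u Metric.isClosed_closedBall.measurableSet
    _ ≤ ∑' k, μH[s] (E ∩ Metric.ball (y k) (r k) ∩ lineProj u ⁻¹' Metric.closedBall x ε) :=
        (measure_mono hslab).trans (measure_iUnion_le _)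
    _ ≤ ∑' k, K * ENNReal.ofReal (r k) ^ (s - 1) * (C * volume (Metric.closedBall x ε)) :=
        ENNReal.tsum_le_tsum hpiece
    _ = K * (∑' k, ENNReal.ofReal (r k) ^ (s - 1)) * (C * volume (Metric.closedBall x ε)) := by
        rw [ENNReal.tsum_mul_right, ENNReal.tsum_mul_left]
    _ ≤ K * η * (C * volume (Metric.closedBall x ε)) := by gcongr

theorem theorem6p3 {n l : ℕ} (S : HomothetyIFS n l) (E : Set (EuclideanSpace ℝ (Fin n)))
    (hE : S.IsAttractor E) (hosc : S.OpenSetCondition) (hscc : S.SliceCodingCondition E)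
    (s : ℝ≥0) (hs : dimH E = (s : ℝ≥0∞))
    (u : EuclideanSpace ℝ (Fin n)) (hu : ‖u‖ = 1)
    (hbd : HasBoundedDensity (projHausdorff E (s : ℝ) u)) :
    ∀ᵐ t ∂(projHausdorff E (s : ℝ) u),
      0 < (μH[(s : ℝ) - 1] : Measure (EuclideanSpace ℝ (Fin n))) (slice E u t) := by
  have hcomp := hE.2.1
  rcases le_or_gt (s : ℝ) 1 with h1 | h1
  · -- Here `s - 1 ≤ 0`, so that the measure is at least the counting measure, and almost every
    -- slice is nonempty.
    have hmem : ∀ᵐ y ∂((μH[(s : ℝ)] : Measure (EuclideanSpace ℝ (Fin n))).restrict E), y ∈ E :=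
      ae_restrict_mem hcomp.measurableSet
    have hproj : ∀ᵐ t ∂(projHausdorff E (s : ℝ) u), t ∈ lineProj u '' E := by
      refine (ae_map_iff (p := (· ∈ lineProj u '' E)) (measurable_lineProj u).aemeasurable
        (hcomp.image (continuous_lineProj u)).measurableSet).2 ?_
      filter_upwards [hmem] with y hy using mem_image_of_mem _ hy
    filter_upwards [hproj] with t ht
    obtain ⟨y, hy, hyt⟩ := ht
    calc (0 : ℝ≥0∞) < μH[0] ({y} : Set (EuclideanSpace ℝ (Fin n))) := by simp
      _ ≤ μH[0] (slice E u t) := measure_mono (singleton_subset_iff.2 ⟨hy, hyt⟩)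
      _ ≤ μH[(s : ℝ) - 1] (slice E u t) := hausdorffMeasure_mono (by linarith) _
  · obtain ⟨K, hK⟩ := hosc.exists_card_cover_le hE
    obtain ⟨h, hmeas, ⟨C, hhC⟩, hν⟩ := hbd
    have hmeas' : Measurable fun t => (h t : ℝ≥0∞) := hmeas.coe_nnreal_ennreal
    have hC : projHausdorff E (s : ℝ) u ≤ (C : ℝ≥0∞) • volume := by
      rw [hν, ← withDensity_const]
      refine withDensity_mono ?_
      filter_upwards [hhC] with t ht
      exact_mod_cast ht
    have hlf' : IsLocallyFiniteMeasure (C • (volume : Measure ℝ)) := inferInstance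
    have hlf : IsLocallyFiniteMeasure (projHausdorff E (s : ℝ) u) :=
      isLocallyFiniteMeasure_of_le (μ := C • (volume : Measure ℝ)) hC
    have hrn := Besicovitch.ae_tendsto_rnDeriv (projHausdorff E (s : ℝ) u) volume
    have hrn' : (projHausdorff E (s : ℝ) u).rnDeriv volume =ᵐ[volume] fun t => (h t : ℝ≥0∞) := by
      rw [hν]
      exact rnDeriv_withDensity _ hmeas'
    rw [hν, ae_withDensity_iff hmeas']
    filter_upwards [hrn, hrn'] with x hlim heq hx
    rw [heq] at hlim
    by_contra hzero
    have hzero' : μH[(s : ℝ) - 1] (slice E u x) = 0 := by simpa using hzero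
    refine hx (le_antisymm ?_ bot_le)
    have hbound : ∀ η : ℝ≥0, 0 < η → (h x : ℝ≥0∞) ≤ K * η * C := by
      intro η hη
      refine le_of_tendsto hlim ?_
      filter_upwards [eventually_projHausdorff_closedBall_le hcomp h1 hC hK hzero'
        (ENNReal.coe_ne_zero.2 hη.ne')] with ε hε
      refine ENNReal.div_le_of_le_mul ?_
      rwa [mul_assoc (_ * _)]
    have hlim0 : Filter.Tendsto (fun η : ℝ≥0 => ((K * η * C : ℝ≥0) : ℝ≥0∞))
        (nhdsWithin 0 (Ioi 0)) (nhds 0) := by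
      have hc : Continuous fun η : ℝ≥0 => ((K * η * C : ℝ≥0) : ℝ≥0∞) := by fun_prop
      simpa using (hc.tendsto 0).mono_left nhdsWithin_le_nhds
    refine ge_of_tendsto hlim0 ?_
    filter_upwards [self_mem_nhdsWithin] with η hη
    simpa using hbound η hη
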